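/- Let $X$ be a Polish space with its Borel $\sigma$-algebra and let $\mu$ be a Borel probability measure on $X$ without atoms. Let $(T_t)_{t\in\mathbb{R}}$ be a flow on $(X,\mu)$: $T_0=\mathrm{Id}$, $T_t\circ T_s=T_{t+s}$ for all $s,t\in\mathbb{R}$, each $T_t$ preserves $\mu$, and $(t,x)\mapsto T_t(x)$ is measurable. Suppose that $(T_t)$ is of rank one with flat roof, that is, there are measurable sets $E_j\subset X$, real numbers $s_j>0$ and integers $h_j\ge 1$ ($j\in\mathbb{N}$) such that: (i) for every $j$ the sets $E_j, T_{s_j}E_j,\dots,T_{s_j}^{h_j-1}E_j$ are pairwise disjoint, so that together with the rest of the space they form a partition $\xi_j=\{E_j,T_{s_j}E_j,\dots,T_{s_j}^{h_j-1}E_j,\ X\setminus\bigsqcup_{i=0}^{h_j-1}T_{s_j}^iE_j\}$; (ii) $\xi_j$ converges to the partition into points: for every measurable set $A$ there are sets $A_j$, each a union of elements of $\xi_j$, with $\mu(A\mathbin{\triangle}A_j)\to 0$; (iii) $s_j/s_{j+1}$ is an integer for every $j$, $s_j\to 0$, and $s_jh_j\to\infty$; (iv) (flat roof) $\displaystyle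 \frac{\mu\left(T_{s_j}^{h_j}E_j\mathbin{\triangle}E_j\right)}{\mu(E_j)}\to 0$. Let $\nu$ be an ergodic self-joining of $(T_t)$: a Borel probability measure on $X\times X$ both of whose marginals are $\mu$, and which is invariant and ergodic under $(T_t\times T_t)_{t\in\mathbb{R}}$. For $t\in\mathbb{R}$ let $\Delta^t$ be the probability measure on $X\times X$ with $\Delta^t(A\times B)=\mu(A\cap T_tB)$ for all measurable $A,B$. Then there is a sequence of integers $(k_j)$ such that $\Delta^{k_js_j}\to\nu$ weakly as $j\to\infty$. -/

import Mathlib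

open MeasureTheory Filter Set
open scoped Topology Pointwise

/-!
A flow `(T_t)` on `X` is a measurable action of the additive group `ℝ` preserving the measure:
`T_t x` is `t +ᵥ x`, the image `T_t A` is `t +ᵥ A`, and `T_s ^ i` is `T_(i s)`. The joint
measurability of `(t, x) ↦ T_t x` is `MeasurableVAdd₂ ℝ X`, the invariance of `μ` is
`VAddInvariantMeasure ℝ X μ`. The product flow `T_t × T_t` is the componentwise action
of `ℝ` on `X × X`.
-/

section FlatRoofFlows

variable {X : Type*} [MeasurableSpace X] [AddAction ℝ X]

/-- The union of the levels `E, T_s E, …, T_s^(h-1) E`. -/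
def tower (E : Set X) (s : ℝ) (h : ℕ) : Set X :=
  ⋃ i ∈ Finset.range h, ((i : ℝ) * s) +ᵥ E

/-- The family `ξ = {E, T_s E, …, T_s^(h-1) E, X \ ⋃ i < h, T_s^i E}`. -/
def towerPartition (E : Set X) (s : ℝ) (h : ℕ) : Set (Set X) :=
  insert (tower E s h)ᶜ {B | ∃ i < h, B = ((i : ℝ) * s) +ᵥ E}

/-- A set is `ξ`-measurable, for a finite partition `ξ`, if it is a union of elements of `ξ`. -/
def IsPartitionMeasurable (ξ : Set (Set X)) (A : Set X) : Prop :=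
  ∃ F ⊆ ξ, A = ⋃₀ F

/-- The sequence of partitions `ξ_j`, given by the bases `E_j`, the steps `s_j` and the
heights `h_j`, exhibits the flow as a flow of rank one. -/
structure IsRankOneSequence (μ : Measure X) (E : ℕ → Set X) (s : ℕ → ℝ) (h : ℕ → ℕ) :
    Prop where
  measurableSet_base : ∀ j, MeasurableSet (E j)
  step_pos : ∀ j, 0 < s j
  height_pos : ∀ j, 0 < h j
  /-- the levels of each tower are pairwise disjoint -/
  disjoint_levels : ∀ j, ∀ i < h j, ∀ l < h j, i ≠ l →
    Disjoint (((i : ℝ) * s j) +ᵥ E j) (((l : ℝ) * s j) +ᵥ E j)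
  /-- the partitions converge to the partition into points -/
  converges : ∀ A : Set X, MeasurableSet A → ∃ A' : ℕ → Set X,
    (∀ j, IsPartitionMeasurable (towerPartition (E j) (s j) (h j)) (A' j)) ∧
    Tendsto (fun j => μ (symmDiff A (A' j))) atTop (𝓝 0)
  step_ratio : ∀ j, ∃ m : ℤ, s j / s (j + 1) = m
  step_tendsto : Tendsto s atTop (𝓝 0)
  length_tendsto : Tendsto (fun j => s j * (h j : ℝ)) atTop atTop

/-- A rank-one sequence with flat roof: `μ (T_{s_j}^{h_j} E_j ∆ E_j) / μ (E_j) → 0`.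
(The other conditions force `μ (E_j) > 0` for all large `j` when `μ` has no atoms.) -/
structure IsFlatRoofSequence (μ : Measure X) (E : ℕ → Set X) (s : ℕ → ℝ) (h : ℕ → ℕ) :
    Prop extends IsRankOneSequence μ E s h where
  flat_roof : Tendsto
    (fun j => μ.real (symmDiff (((h j : ℝ) * s j) +ᵥ E j) (E j)) / μ.real (E j)) atTop (𝓝 0)

/-- A self-joining of the flow: both marginals are `μ`, and it is invariant under `T_t × T_t`
for every `t`. -/
structure IsSelfJoining (μ : ProbabilityMeasure X) (ν : ProbabilityMeasure (X × X)) :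
    Prop where
  fst_eq : (ν : Measure (X × X)).fst = μ
  snd_eq : (ν : Measure (X × X)).snd = μ
  invariant : VAddInvariantMeasure ℝ (X × X) (ν : Measure (X × X))

/-- The off-diagonal joining `Δ^t`, the image of `μ` under `x ↦ (x, T_{-t} x)`, so that
`Δ^t (A × B) = μ (A ∩ T_t B)`. -/
noncomputable def offDiagonal [MeasurableVAdd₂ ℝ X] (μ : ProbabilityMeasure X) (t : ℝ) :
    ProbabilityMeasure (X × X) :=
  μ.map (f := fun x => (x, (-t) +ᵥ x))
    (measurable_id.prodMk (measurable_const_vadd (-t))).aemeasurable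

end FlatRoofFlows

/-!
Let `L_i = T_s^i E` be the levels of a tower of height `h`, with `i` read modulo `h`, and let `ν`
be a self-joining. Since `ν` is invariant under `T_s × T_s` and the roof is flat, the matrix `ν
(L_i × L_l)` is almost constant along each cyclic diagonal `l = i + k`. The off-diagonal joining
`Δ^(-k s)` is, up to a small error of the same kind, the uniform mass on that diagonal. So on
unions of levels `ν` is nearly the mixture of the `Δ^(-k s)` in which `Δ^(-k s)` has as weight the
mass that `ν` gives to the `k`-th diagonal (`abs_measureReal_prod_sub_sum_diagonalWeight_mul_le`).
Because the partitions converge to the partition into points, and because absence of atoms forces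
the towers to fill the space (`IsRankOneSequence.tendsto_measureReal_compl_tower`), these mixtures
converge to `ν` on all measurable rectangles (`IsFlatRoofSequence.tendsto_sum_diagonalWeight_mul`).

An ergodic measure is extreme among invariant measures, so most members of the mixture must be
close to `ν` by themselves. The argument is quantitative and takes place in `L²(ν)`. For a function
`f` in the algebra generated by rectangles there is another function `u` of this algebra, with the
same integral as `f` against each invariant measure, such that `∫ (u - ∫ f ∂ν)² ∂ν` is small
(`exists_integral_sq_sub_lt`). Integrating `(u - ∫ f ∂ν)²` against the mixture bounds the weighted
average of `(∫ f ∂Δ^(-k s) - ∫ f ∂ν)²` (`tendsto_sum_mul_sq_integral_sub`). Minimizing a weighted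
sum of these squares over a countable family of rectangles that determines weak convergence gives
`k_j` (`exists_forall_tendsto_of_tendsto_sum`).
-/

/-! ### Ergodic actions: averaging in `L²` and extremality -/

section Ergodic

variable {G Y : Type*} [AddGroup G] [AddAction G Y] [MeasurableSpace Y]

/-- The analogue for group actions of `QuasiErgodic.ae_eq_const_of_ae_eq_comp₀`. -/
theorem ErgodicVAdd.ae_eq_const_of_forall_ae_eq [MeasurableConstVAdd G Y] {ν : Measure Y}
    [ErgodicVAdd G Y ν] {f : Y → ℝ} (hf : AEStronglyMeasurable f ν)
    (hinv : ∀ g : G, (fun y => f (g +ᵥ y)) =ᵐ[ν] f) : ∃ c : ℝ, f =ᵐ[ν] fun _ => c := by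
  refine exists_eventuallyEq_const_of_forall_separating MeasurableSet fun U hU => ?_
  have h := MeasureTheory.aeconst_of_forall_preimage_vadd_ae_eq G (μ := ν) (s := f ⁻¹' U)
    (hf.aemeasurable.nullMeasurable hU)
    (fun g => ((hinv g).mono fun y hy => by
      simp only [mem_preimage] at *
      rw [hy]).set_eq)
  rw [eventuallyConst_set'] at h
  rcases h with h | h
  · right
    filter_upwards [h.mem_iff] with y hy
    simpa using hy
  · left
    filter_upwards [h.mem_iff] with y hy
    simpa using hy

/-- Uniqueness of the point of minimal norm in a convex set. -/
theorem eq_of_norm_eq_iInf_norm {H : Type*} [NormedAddCommGroup H] [InnerProductSpace ℝ H]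
    {K : Set H} (hK : Convex ℝ K) {v w : H} (hv : v ∈ K) (hw : w ∈ K)
    (hmin : ‖(0 : H) - v‖ = ⨅ x : K, ‖(0 : H) - x‖) (hvw : ‖w‖ = ‖v‖) : w = v := by
  have h := (norm_eq_iInf_iff_real_inner_le_zero hK hv).1 hmin w hw
  have h1 : ‖w - v‖ ^ 2 ≤ 0 := by
    rw [zero_sub, inner_neg_left, inner_sub_right, real_inner_self_eq_norm_sq] at h
    rw [norm_sub_sq_real, real_inner_comm, hvw]
    linarith
  have h2 : ‖w - v‖ = 0 := by
    have := sq_nonneg ‖w - v‖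
    exact pow_eq_zero_iff (two_ne_zero) |>.1 (le_antisymm h1 this)
  exact sub_eq_zero.1 (norm_eq_zero.1 h2)

/-- A mean ergodic theorem for an arbitrary acting group: inside an invariant space `D` of bounded
functions, `f` can be replaced by some `u` which is `L²(ν)`-close to the constant `∫ f ∂ν` and has
the same integral as `f` against every invariant probability measure. The functions `u` with the
same integrals as `f` form a convex invariant set, and the point of minimal norm in its closure is
invariant, hence constant by ergodicity. -/
theorem exists_integral_sq_sub_lt [MeasurableConstVAdd G Y] {ν : Measure Y}
    [IsProbabilityMeasure ν] [ErgodicVAdd G Y ν] (D : Submodule ℝ (Y → ℝ))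
    (hmeas : ∀ f ∈ D, Measurable f) (hbdd : ∀ f ∈ D, ∃ C : ℝ, ∀ y, ‖f y‖ ≤ C)
    (hinv : ∀ f ∈ D, ∀ g : G, (fun y => f (g +ᵥ y)) ∈ D) {f : Y → ℝ} (hf : f ∈ D)
    {ε : ℝ} (hε : 0 < ε) :
    ∃ u ∈ D, (∀ ρ : Measure Y, IsProbabilityMeasure ρ → VAddInvariantMeasure G Y ρ →
        ∫ y, u y ∂ρ = ∫ y, f y ∂ρ) ∧
      ∫ y, (u y - ∫ z, f z ∂ν) ^ 2 ∂ν < ε := by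
  have hLp : ∀ u ∈ D, ∀ ρ : Measure Y, IsProbabilityMeasure ρ → MemLp u 2 ρ := by
    intro u hu ρ _
    obtain ⟨C, hC⟩ := hbdd u hu
    exact MemLp.of_bound (hmeas u hu).aestronglyMeasurable C (ae_of_all _ hC)
  have hint : ∀ u ∈ D, ∀ ρ : Measure Y, IsProbabilityMeasure ρ → Integrable u ρ :=
    fun u hu ρ hρ => (hLp u hu ρ hρ).integrable (by norm_num)
  let P : (Y → ℝ) → Prop := fun u => ∀ ρ : Measure Y, IsProbabilityMeasure ρ →
    VAddInvariantMeasure G Y ρ → ∫ y, u y ∂ρ = ∫ y, f y ∂ρ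
  let C : Set (Lp ℝ 2 ν) := {x | ∃ u ∈ D, P u ∧ x =ᵐ[ν] u}
  have hCconv : Convex ℝ C := by
    rintro x ⟨u, hu, hPu, hxu⟩ y ⟨v, hv, hPv, hyv⟩ a b ha hb hab
    refine ⟨a • u + b • v, D.add_mem (D.smul_mem a hu) (D.smul_mem b hv), ?_, ?_⟩
    · intro ρ hρ hρi
      simp only [Pi.add_apply, Pi.smul_apply, smul_eq_mul]
      rw [integral_add ((hint u hu ρ hρ).const_mul a) ((hint v hv ρ hρ).const_mul b),
        integral_const_mul, integral_const_mul, hPu ρ hρ hρi, hPv ρ hρ hρi, ← add_mul, hab, one_mul]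
    · filter_upwards [hxu, hyv, Lp.coeFn_add (a • x) (b • y), Lp.coeFn_smul a x,
        Lp.coeFn_smul b y] with z h1 h2 h3 h4 h5
      rw [h3]
      simp [h4, h5, h1, h2]
  have hCne : C.Nonempty :=
    ⟨(hLp f hf ν inferInstance).toLp f, f, hf, fun _ _ _ => rfl, MemLp.coeFn_toLp _⟩
  have hmp : ∀ g : G, MeasurePreserving (fun y : Y => g +ᵥ y) ν ν :=
    fun g => measurePreserving_vadd g ν
  have hCinv : ∀ g : G, ∀ x ∈ C, Lp.compMeasurePreserving _ (hmp g) x ∈ C := by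
    rintro g x ⟨u, hu, hPu, hxu⟩
    refine ⟨_, hinv u hu g, ?_, ?_⟩
    · intro ρ hρ hρi
      rw [← hPu ρ hρ hρi]
      have hm := measurePreserving_vadd g ρ
      rw [← integral_map (f := u) hm.measurable.aemeasurable, hm.map_eq]
      exact (hmeas u hu).aestronglyMeasurable
    · exact (Lp.coeFn_compMeasurePreserving x (hmp g)).trans
        ((hmp g).quasiMeasurePreserving.ae_eq_comp hxu)
  obtain ⟨v, hv, hvmin⟩ := exists_norm_eq_iInf_of_complete_convex (K := closure C)
    hCne.closure isClosed_closure.isComplete hCconv.closure 0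
  have hvinv : ∀ g : G, Lp.compMeasurePreserving _ (hmp g) v = v := by
    intro g
    refine eq_of_norm_eq_iInf_norm hCconv.closure hv ?_ hvmin
      (Lp.norm_compMeasurePreserving v (hmp g))
    exact map_mem_closure (Lp.isometry_compMeasurePreserving (hmp g)).continuous hv (hCinv g)
  obtain ⟨c, hc⟩ := ErgodicVAdd.ae_eq_const_of_forall_ae_eq (G := G) (ν := ν) (f := v)
    (Lp.aestronglyMeasurable v) (fun g => by
      have h := Lp.coeFn_compMeasurePreserving v (hmp g)
      rw [hvinv g] at h
      exact h.symm)
  obtain ⟨x, ⟨u, hu, hPu, hxu⟩, hx⟩ := Metric.mem_closure_iff.1 hv (√ε) (Real.sqrt_pos.2 hε)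
  refine ⟨u, hu, hPu, ?_⟩
  have hm : ∫ y, u y ∂ν = ∫ y, f y ∂ν := hPu ν inferInstance inferInstance
  have hsq : ∫ y, (u y - c) ^ 2 ∂ν < ε := by
    have h1 : ‖v - x‖ ^ 2 = ∫ y, (u y - c) ^ 2 ∂ν := by
      rw [← real_inner_self_eq_norm_sq, L2.inner_def]
      refine integral_congr_ae ?_
      filter_upwards [hc, hxu, Lp.coeFn_sub v x] with y h1 h2 h3
      rw [h3, Pi.sub_apply, h1, h2]
      simp only [inner_self_eq_norm_sq_to_K, Real.norm_eq_abs, RCLike.ofReal_real_eq_id, id_eq,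
        sq_abs]
      ring
    rw [← h1]
    rw [dist_eq_norm] at hx
    calc ‖v - x‖ ^ 2 < √ε ^ 2 := by gcongr
      _ = ε := Real.sq_sqrt hε.le
  -- the mean minimizes the quadratic deviation
  have hexp : ∀ a : ℝ, ∫ y, (u y - a) ^ 2 ∂ν
      = ∫ y, u y ^ 2 ∂ν - 2 * a * ∫ y, u y ∂ν + a ^ 2 := by
    intro a
    have hi := hint u hu ν inferInstance
    have hi2 : Integrable (fun y => u y ^ 2) ν := (hLp u hu ν inferInstance).integrable_sq
    have : (fun y => (u y - a) ^ 2) = fun y => (u y ^ 2 - (2 * a) * u y) + a ^ 2 := by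
      funext y; ring
    have h2 : ∫ y, (u y ^ 2 - 2 * a * u y) ∂ν = ∫ y, u y ^ 2 ∂ν - 2 * a * ∫ y, u y ∂ν := by
      rw [integral_sub hi2 (hi.const_mul _), integral_const_mul]
    rw [this, integral_add (f := fun y => u y ^ 2 - 2 * a * u y) (hi2.sub (hi.const_mul _))
      (integrable_const _), h2]
    simp
  rw [hexp] at hsq ⊢
  rw [hm] at hsq ⊢
  nlinarith [sq_nonneg (c - ∫ y, f y ∂ν)]

/-- Quantitative extremality of an ergodic measure `ν`: if mixtures of invariant measures `P j k`
with weights `w j k` converge to `ν` on an algebra `D` of functions, then on average the single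
measures `P j k` are already close to `ν` on each `f ∈ D`. -/
theorem tendsto_sum_mul_sq_integral_sub [MeasurableConstVAdd G Y] {ν : ProbabilityMeasure Y}
    [ErgodicVAdd G Y (ν : Measure Y)] (D : Subalgebra ℝ (Y → ℝ))
    (hmeas : ∀ f ∈ D, Measurable f) (hbdd : ∀ f ∈ D, ∃ C : ℝ, ∀ y, ‖f y‖ ≤ C)
    (hinv : ∀ f ∈ D, ∀ g : G, (fun y => f (g +ᵥ y)) ∈ D)
    {ι : ℕ → Type*} [∀ j, Fintype (ι j)] {w : ∀ j, ι j → ℝ} (hw : ∀ j k, 0 ≤ w j k)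
    {P : ∀ j, ι j → ProbabilityMeasure Y}
    (hP : ∀ j k, VAddInvariantMeasure G Y (P j k : Measure Y))
    (hlim : ∀ f ∈ D, Tendsto (fun j => ∑ k, w j k * ∫ y, f y ∂(P j k : Measure Y)) atTop
      (𝓝 (∫ y, f y ∂(ν : Measure Y)))) {f : Y → ℝ} (hf : f ∈ D) :
    Tendsto (fun j => ∑ k, w j k *
      (∫ y, f y ∂(P j k : Measure Y) - ∫ y, f y ∂(ν : Measure Y)) ^ 2) atTop (𝓝 0) := by
  have hnn : ∀ j, 0 ≤ ∑ k, w j k *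
      (∫ y, f y ∂(P j k : Measure Y) - ∫ y, f y ∂(ν : Measure Y)) ^ 2 :=
    fun j => Finset.sum_nonneg fun k _ => mul_nonneg (hw j k) (sq_nonneg _)
  refine tendsto_order.2 ⟨fun a ha => Eventually.of_forall fun j => ha.trans_le (hnn j),
    fun ε hε => ?_⟩
  obtain ⟨u, hu, hint, hlt⟩ := exists_integral_sq_sub_lt (ν := (ν : Measure Y)) (G := G)
    (Subalgebra.toSubmodule D) hmeas hbdd hinv hf hε
  set m := ∫ y, f y ∂(ν : Measure Y)
  -- `(∫ f ∂P - m)² = (∫ (u - m) ∂P)² ≤ ∫ (u - m)² ∂P`, and the mixture of the right-hand sides is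
  -- eventually below `ε` because `(u - m)²` belongs to `D`
  have hv : (fun y => (u y - m) ^ 2) ∈ D :=
    D.pow_mem (D.sub_mem hu (D.algebraMap_mem m)) 2
  filter_upwards [(hlim _ hv).eventually_lt_const hlt] with j hj
  refine lt_of_le_of_lt (Finset.sum_le_sum fun k _ => ?_) hj
  refine mul_le_mul_of_nonneg_left ?_ (hw j k)
  rw [← hint _ inferInstance (hP j k)]
  have hLp : MemLp (fun y => u y - m) 2 (P j k : Measure Y) := by
    obtain ⟨C, hC⟩ := hbdd _ (D.sub_mem hu (D.algebraMap_mem m))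
    exact MemLp.of_bound (hmeas _ (D.sub_mem hu (D.algebraMap_mem m))).aestronglyMeasurable C
      (ae_of_all _ hC)
  have hui : Integrable u (P j k : Measure Y) := by
    have := (hLp.integrable (by norm_num)).add (integrable_const m)
    simpa [Pi.add_def] using this
  have h1 : ∫ y, u y ∂(P j k : Measure Y) - m = ∫ y, (u y - m) ∂(P j k : Measure Y) := by
    rw [integral_sub hui (integrable_const _)]
    simp
  rw [h1]
  have h2 := ProbabilityTheory.variance_nonneg (fun y => u y - m) (P j k : Measure Y)
  rw [ProbabilityTheory.variance_eq_sub hLp] at h2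
  simpa using h2

/-- If countably many quantities `F n` have weighted averages tending to `0`, then one can select
for each `j` an index `k j` along which every `F n` tends to `0`. -/
theorem exists_forall_tendsto_of_tendsto_sum {ι : ℕ → Type*} [∀ j, Fintype (ι j)]
    {w : ∀ j, ι j → ℝ} (hw : ∀ j k, 0 ≤ w j k)
    (hw1 : Tendsto (fun j => ∑ k, w j k) atTop (𝓝 1)) {F : ℕ → ∀ j, ι j → ℝ}
    (hF0 : ∀ n j k, 0 ≤ F n j k) (hF1 : ∀ n j k, F n j k ≤ 1)
    (hF : ∀ n, Tendsto (fun j => ∑ k, w j k * F n j k) atTop (𝓝 0))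
    (hne : ∀ j, Nonempty (ι j)) :
    ∃ k : ∀ j, ι j, ∀ n, Tendsto (fun j => F n j (k j)) atTop (𝓝 0) := by
  let Φ : ∀ j, ι j → ℝ := fun j k => ∑' n, (1 / 2 : ℝ) ^ n * F n j k
  have hle : ∀ n j k, (1 / 2 : ℝ) ^ n * F n j k ≤ (1 / 2 : ℝ) ^ n := fun n j k =>
    mul_le_of_le_one_right (by positivity) (hF1 n j k)
  have hnn : ∀ n j k, 0 ≤ (1 / 2 : ℝ) ^ n * F n j k := fun n j k =>
    mul_nonneg (by positivity) (hF0 n j k)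
  have hsum : ∀ j k, Summable fun n => (1 / 2 : ℝ) ^ n * F n j k := fun j k =>
    Summable.of_nonneg_of_le (fun n => hnn n j k) (fun n => hle n j k) summable_geometric_two
  have hΦ0 : ∀ j k, 0 ≤ Φ j k := fun j k => tsum_nonneg fun n => hnn n j k
  have hsumΦ : ∀ j, ∑ k, w j k * Φ j k = ∑' n, (1 / 2 : ℝ) ^ n * ∑ k, w j k * F n j k := by
    intro j
    simp only [Φ, ← tsum_mul_left, Finset.mul_sum]
    rw [← Summable.tsum_finsetSum (fun k _ => (hsum j k).mul_left (w j k))]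
    exact tsum_congr fun n => Finset.sum_congr rfl fun k _ => by ring
  -- exchanging the sums reduces this to the hypothesis for each `n`, by dominated convergence
  have hΦlim : Tendsto (fun j => ∑ k, w j k * Φ j k) atTop (𝓝 0) := by
    simp only [hsumΦ]
    have := tendsto_tsum_of_dominated_convergence (𝓕 := atTop)
      (f := fun j n => (1 / 2 : ℝ) ^ n * ∑ k, w j k * F n j k) (g := fun _ => (0 : ℝ))
      (bound := fun n => (1 / 2 : ℝ) ^ n * 2) (summable_geometric_two.mul_right 2)
      (fun n => by simpa using (hF n).const_mul ((1 / 2 : ℝ) ^ n)) (by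
        filter_upwards [hw1.eventually_le_const (show (1 : ℝ) < 2 by norm_num)] with j hj n
        have h0 : 0 ≤ ∑ k, w j k * F n j k :=
          Finset.sum_nonneg fun k _ => mul_nonneg (hw j k) (hF0 n j k)
        rw [Real.norm_of_nonneg (by positivity)]
        refine mul_le_mul_of_nonneg_left (le_trans ?_ hj) (by positivity)
        exact Finset.sum_le_sum fun k _ => mul_le_of_le_one_right (hw j k) (hF1 n j k))
    simpa using this
  -- the minimum over `k` is at most twice the weighted sum once the weights add up to `1 / 2`
  choose k hk using fun j => Finite.exists_min (Φ j)
  have hkΦ : Tendsto (fun j => Φ j (k j)) atTop (𝓝 0) := by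
    have h2 : Tendsto (fun j => 2 * ∑ i, w j i * Φ j i) atTop (𝓝 0) := by
      simpa using hΦlim.const_mul 2
    refine squeeze_zero' (Eventually.of_forall fun j => hΦ0 j _) ?_ h2
    filter_upwards [hw1.eventually_const_le (show (1 / 2 : ℝ) < 1 by norm_num)] with j hj
    have h3 : (∑ i, w j i) * Φ j (k j) ≤ ∑ i, w j i * Φ j i := by
      rw [Finset.sum_mul]
      exact Finset.sum_le_sum fun i _ => mul_le_mul_of_nonneg_left (hk j i) (hw j i)
    nlinarith [hΦ0 j (k j)]
  refine ⟨k, fun n => ?_⟩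
  have h4 : Tendsto (fun j => 2 ^ n * Φ j (k j)) atTop (𝓝 0) := by
    simpa using hkΦ.const_mul ((2 : ℝ) ^ n)
  refine squeeze_zero (fun j => hF0 n j _) (fun j => ?_) h4
  have h5 : (1 / 2 : ℝ) ^ n * F n j (k j) ≤ Φ j (k j) :=
    (hsum j (k j)).le_tsum n fun i _ => hnn i j (k j)
  calc F n j (k j) = 2 ^ n * ((1 / 2 : ℝ) ^ n * F n j (k j)) := by
        rw [← mul_assoc, ← mul_pow]; norm_num
    _ ≤ _ := by gcongr

end Ergodic

/-! ### Matrices indexed by a cyclic group -/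

section Cyclic

variable {h : ℕ} [NeZero h]

theorem sum_abs_sub_add_natCast_le {a : ZMod h → ZMod h → ℝ} {η : ℝ}
    (hη : ∑ i, ∑ l, |a (i + 1) (l + 1) - a i l| ≤ η) (n : ℕ) :
    ∑ i, ∑ l, |a (i + n) (l + n) - a i l| ≤ n * η := by
  induction n with
  | zero => simp
  | succ n ih =>
    have h1 : ∑ i, ∑ l, |a (i + n + 1) (l + n + 1) - a (i + n) (l + n)| ≤ η := by
      rw [Fintype.sum_equiv (Equiv.addRight (n : ZMod h)) _
        (fun i => ∑ l, |a (i + 1) (l + 1) - a i l|)]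
      · exact hη
      · intro i
        exact Fintype.sum_equiv (Equiv.addRight (n : ZMod h)) _ _ fun l => rfl
    calc ∑ i, ∑ l, |a (i + (n + 1 : ℕ)) (l + (n + 1 : ℕ)) - a i l|
        ≤ ∑ i, ∑ l, (|a (i + n + 1) (l + n + 1) - a (i + n) (l + n)|
            + |a (i + n) (l + n) - a i l|) := by
          refine Finset.sum_le_sum fun i _ => Finset.sum_le_sum fun l _ => ?_
          push_cast
          rw [← add_assoc, ← add_assoc]
          exact abs_sub_le _ _ _
      _ ≤ η + n * η := by
          simp only [Finset.sum_add_distrib]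
          exact add_le_add h1 ih
      _ = (n + 1 : ℕ) * η := by push_cast; ring

/-- A matrix which changes little under the shift along the diagonals is close, in `ℓ¹`, to the
matrix of its averages along the cyclic diagonals. -/
theorem sum_abs_sub_diagonal_average_le {a : ZMod h → ZMod h → ℝ} {η : ℝ}
    (hη : ∑ i, ∑ l, |a (i + 1) (l + 1) - a i l| ≤ η) :
    ∑ i, ∑ l, |a i l - (h : ℝ)⁻¹ * ∑ m, a m (m + (l - i))| ≤ h * η := by
  have hh : (0 : ℝ) < h := Nat.cast_pos.2 (NeZero.pos h)
  have hη0 : 0 ≤ η := le_trans (Finset.sum_nonneg fun i _ => Finset.sum_nonneg fun l _ =>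
    abs_nonneg _) hη
  have hpt : ∀ i l, |a i l - (h : ℝ)⁻¹ * ∑ m, a m (m + (l - i))|
      ≤ (h : ℝ)⁻¹ * ∑ m, |a (i + m) (l + m) - a i l| := by
    intro i l
    have h1 : ∑ m, a m (m + (l - i)) = ∑ m, a (i + m) (l + m) := by
      refine (Fintype.sum_equiv (Equiv.addLeft i) _ _ fun m => ?_).symm
      simp only [Equiv.coe_addLeft]
      congr 1
      ring
    have h2 : a i l - (h : ℝ)⁻¹ * ∑ m, a m (m + (l - i))
        = -((h : ℝ)⁻¹ * ∑ m, (a (i + m) (l + m) - a i l)) := by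
      rw [h1, Finset.sum_sub_distrib, Finset.sum_const, Finset.card_univ, ZMod.card, nsmul_eq_mul]
      field_simp
      ring
    rw [h2, abs_neg, abs_mul, abs_of_pos (inv_pos.2 hh)]
    exact mul_le_mul_of_nonneg_left (Finset.abs_sum_le_sum_abs _ _) (inv_pos.2 hh).le
  calc ∑ i, ∑ l, |a i l - (h : ℝ)⁻¹ * ∑ m, a m (m + (l - i))|
      ≤ ∑ i, ∑ l, (h : ℝ)⁻¹ * ∑ m, |a (i + m) (l + m) - a i l| :=
        Finset.sum_le_sum fun i _ => Finset.sum_le_sum fun l _ => hpt i l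
    _ = (h : ℝ)⁻¹ * ∑ m, ∑ i, ∑ l, |a (i + m) (l + m) - a i l| := by
        simp only [← Finset.mul_sum]
        congr 1
        symm
        rw [Finset.sum_comm]
        exact Finset.sum_congr rfl fun i _ => Finset.sum_comm
    _ ≤ (h : ℝ)⁻¹ * ∑ m : ZMod h, h * η := by
        gcongr with m
        have := sum_abs_sub_add_natCast_le hη m.val
        simp only [ZMod.natCast_zmod_val] at this
        refine this.trans ?_
        gcongr
        exact (ZMod.val_lt m).le
    _ = h * η := by
        rw [Finset.sum_const, Finset.card_univ, ZMod.card, nsmul_eq_mul]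
        field_simp

/-- The combinatorial core. Here `a` is the matrix of `ν` on the cells `T_s^i E × T_s^l E` of a
tower, `b k` that of the `k`-th off-diagonal joining, `e = μ (E)`, and `δ` is the measure of
`T_s^h E ∆ E`. Both `a` and the mixture of the `b k` with the weights of the diagonals of `a` are
compared with the matrix that is constant on each cyclic diagonal. -/
theorem abs_sum_sub_sum_diagonal_weight_le {a : ZMod h → ZMod h → ℝ}
    {b : ZMod h → ZMod h → ZMod h → ℝ} {e δ : ℝ} (ha0 : ∀ i l, 0 ≤ a i l)
    (ha1 : ∑ i, ∑ l, a i l ≤ 1) (hstep : ∑ i, ∑ l, |a (i + 1) (l + 1) - a i l| ≤ 2 * δ)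
    (he : h * e ≤ 1) (hδ : 0 ≤ δ) (hb0 : ∀ k i l, 0 ≤ b k i l)
    (hb1 : ∀ k, ∑ i, ∑ l, b k i l ≤ 1) (hb : ∀ k i, e - δ ≤ b k i (i + k))
    (I J : Finset (ZMod h)) :
    |∑ i ∈ I, ∑ l ∈ J, a i l - ∑ k, (∑ m, a m (m + k)) * ∑ i ∈ I, ∑ l ∈ J, b k i l|
      ≤ 4 * (h * δ) + 2 * (1 - h * e) := by
  have hh : (0 : ℝ) < h := Nat.cast_pos.2 (NeZero.pos h)
  set w : ZMod h → ℝ := fun k => ∑ m, a m (m + k) with hwdef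
  have hw0 : ∀ k, 0 ≤ w k := fun k => Finset.sum_nonneg fun m _ => ha0 _ _
  have hw1 : ∑ k, w k ≤ 1 := by
    rw [hwdef, Finset.sum_comm]
    refine le_trans (le_of_eq (Finset.sum_congr rfl fun i _ => ?_)) ha1
    exact Fintype.sum_equiv (Equiv.addLeft i) _ _ fun _ => rfl
  have hrow : ∀ i : ZMod h, ∑ l, w (l - i) = ∑ k, w k := fun i =>
    Fintype.sum_equiv (Equiv.subRight i) _ _ fun _ => rfl
  let c : ZMod h → ZMod h → ZMod h → ℝ := fun k i l => if l = i + k then e else 0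
  have hwc : ∀ i l, ∑ k, w k * c k i l = e * w (l - i) := by
    intro i l
    rw [Finset.sum_eq_single (l - i)]
    · simp [c, mul_comm]
    · intro k _ hk
      have : l ≠ i + k := fun h => hk (by rw [h]; ring)
      simp [c, this]
    · simp
  -- the joining is close to its average along the diagonals
  have h1 : ∑ i, ∑ l, |a i l - e * w (l - i)| ≤ 2 * (h * δ) + (1 - h * e) := by
    calc ∑ i, ∑ l, |a i l - e * w (l - i)|
        ≤ ∑ i, ∑ l, (|a i l - (h : ℝ)⁻¹ * w (l - i)| + ((h : ℝ)⁻¹ - e) * w (l - i)) := by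
          refine Finset.sum_le_sum fun i _ => Finset.sum_le_sum fun l _ => ?_
          have he' : 0 ≤ (h : ℝ)⁻¹ - e := by
            rw [sub_nonneg, ← one_div, le_div_iff₀ hh]
            linarith
          calc |a i l - e * w (l - i)|
              = |(a i l - (h : ℝ)⁻¹ * w (l - i)) + ((h : ℝ)⁻¹ - e) * w (l - i)| := by
                congr 1; ring
            _ ≤ _ := by
                refine (abs_add_le _ _).trans ?_
                rw [abs_of_nonneg (mul_nonneg he' (hw0 _))]
      _ = ∑ i, ∑ l, |a i l - (h : ℝ)⁻¹ * w (l - i)| + (1 - h * e) * ∑ k, w k := by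
          simp only [Finset.sum_add_distrib, ← Finset.mul_sum, hrow]
          rw [Finset.sum_const, Finset.card_univ, ZMod.card, nsmul_eq_mul]
          congr 1
          field_simp
      _ ≤ h * (2 * δ) + (1 - h * e) := by
          refine add_le_add (sum_abs_sub_diagonal_average_le hstep) ?_
          exact mul_le_of_le_one_right (by linarith) hw1
      _ = _ := by ring
  -- `b k` has total mass at most `1`, so a lower bound on its `k`-th diagonal suffices
  have h2 : ∀ k, ∑ i, ∑ l, |c k i l - b k i l| ≤ 2 * (h * δ) + (1 - h * e) := by
    intro k
    calc ∑ i, ∑ l, |c k i l - b k i l|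
        ≤ ∑ i, ∑ l, (b k i l - c k i l + 2 * (if l = i + k then δ else 0)) := by
          refine Finset.sum_le_sum fun i _ => Finset.sum_le_sum fun l _ => ?_
          rw [abs_le]
          by_cases hl : l = i + k
          · have := hb k i
            subst hl
            simp only [c, if_true]
            constructor <;> linarith
          · have := hb0 k i l
            simp only [c, hl, if_false]
            constructor <;> linarith
      _ = ∑ i, ∑ l, b k i l - h * e + 2 * (h * δ) := by
          simp only [Finset.sum_add_distrib, Finset.sum_sub_distrib, c, ← Finset.mul_sum,
            Finset.sum_ite_eq', Finset.mem_univ, if_true, Finset.sum_const, Finset.card_univ,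
            ZMod.card, nsmul_eq_mul]
      _ ≤ _ := by linarith [hb1 k]
  have hsub : ∀ f : ZMod h → ZMod h → ℝ, |∑ i ∈ I, ∑ l ∈ J, f i l| ≤ ∑ i, ∑ l, |f i l| := by
    intro f
    calc |∑ i ∈ I, ∑ l ∈ J, f i l| ≤ ∑ i ∈ I, ∑ l ∈ J, |f i l| :=
          (Finset.abs_sum_le_sum_abs _ _).trans
            (Finset.sum_le_sum fun i _ => Finset.abs_sum_le_sum_abs _ _)
      _ ≤ ∑ i ∈ I, ∑ l, |f i l| := Finset.sum_le_sum fun i _ =>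
          Finset.sum_le_univ_sum_of_nonneg fun l => abs_nonneg _
      _ ≤ _ := Finset.sum_le_univ_sum_of_nonneg fun i =>
          Finset.sum_nonneg fun l _ => abs_nonneg _
  have hdecomp : ∑ i ∈ I, ∑ l ∈ J, a i l - ∑ k, w k * ∑ i ∈ I, ∑ l ∈ J, b k i l
      = ∑ i ∈ I, ∑ l ∈ J, (a i l - e * w (l - i))
        + ∑ k, w k * ∑ i ∈ I, ∑ l ∈ J, (c k i l - b k i l) := by
    have : ∑ k, w k * ∑ i ∈ I, ∑ l ∈ J, c k i l = ∑ i ∈ I, ∑ l ∈ J, e * w (l - i) := by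
      simp only [Finset.mul_sum]
      rw [Finset.sum_comm]
      refine Finset.sum_congr rfl fun i _ => ?_
      rw [Finset.sum_comm]
      exact Finset.sum_congr rfl fun l _ => hwc i l
    simp only [Finset.sum_sub_distrib, mul_sub, this]
    ring
  rw [hdecomp]
  calc _ ≤ (2 * (h * δ) + (1 - h * e)) + (2 * (h * δ) + (1 - h * e)) := by
        refine (abs_add_le _ _).trans (add_le_add ((hsub _).trans h1) ?_)
        calc |∑ k, w k * ∑ i ∈ I, ∑ l ∈ J, (c k i l - b k i l)|
            ≤ ∑ k, w k * (2 * (h * δ) + (1 - h * e)) := by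
              refine (Finset.abs_sum_le_sum_abs _ _).trans (Finset.sum_le_sum fun k _ => ?_)
              rw [abs_mul, abs_of_nonneg (hw0 k)]
              exact mul_le_mul_of_nonneg_left ((hsub _).trans (h2 k)) (hw0 k)
          _ ≤ _ := by
              rw [← Finset.sum_mul]
              refine mul_le_of_le_one_left ?_ hw1
              have := mul_nonneg hh.le hδ
              linarith
    _ = _ := by ring

end Cyclic

/-! ### Levels of a tower -/

section Levels

variable {X : Type*} [AddAction ℝ X]

/-- The level `T_s^n E`. -/
def towerLevel (E : Set X) (s : ℝ) (n : ℕ) : Set X := ((n : ℝ) * s) +ᵥ E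

theorem vadd_towerLevel (E : Set X) (s : ℝ) (k n : ℕ) :
    ((k : ℝ) * s) +ᵥ towerLevel E s n = towerLevel E s (n + k) := by
  rw [towerLevel, towerLevel, vadd_vadd]
  congr 1
  push_cast
  ring

@[simp]
theorem towerLevel_zero (E : Set X) (s : ℝ) : towerLevel E s 0 = E := by
  simp [towerLevel]

theorem MeasurableSet.towerLevel [MeasurableSpace X] [MeasurableVAdd₂ ℝ X] {E : Set X}
    (hE : MeasurableSet E) (s : ℝ) (n : ℕ) : MeasurableSet (towerLevel E s n) :=
  hE.const_vadd _

/-- Only the top level is affected by reducing `i + 1` modulo `h`. -/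
theorem sum_measureReal_symmDiff_towerLevel_le [MeasurableSpace X] {μ : Measure X}
    {h : ℕ} [NeZero h] (E : Set X) (s : ℝ) :
    ∑ i : ZMod h, μ.real (symmDiff (towerLevel E s (i + 1).val) (towerLevel E s (i.val + 1)))
      ≤ μ.real (symmDiff (towerLevel E s h) E) := by
  calc _ ≤ ∑ i : ZMod h, if i = -1 then μ.real (symmDiff (towerLevel E s h) E) else 0 := by
        refine Finset.sum_le_sum fun i _ => ?_
        split_ifs with hi
        · subst hi
          have h0 : (-1 : ZMod h).val + 1 = h := by
            obtain ⟨n, rfl⟩ := Nat.exists_eq_succ_of_ne_zero (NeZero.ne h)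
            rw [ZMod.val_neg_one]
          rw [h0, neg_add_cancel, ZMod.val_zero, towerLevel_zero, symmDiff_comm]
        · have h0 : (i + 1).val = i.val + 1 := by
            have hlt : i.val + 1 < h := by
              refine lt_of_le_of_ne (ZMod.val_lt i) fun hne => hi ?_
              have : ((i.val + 1 : ℕ) : ZMod h) = 0 := by rw [hne]; simp
              push_cast at this
              rw [ZMod.natCast_zmod_val] at this
              exact eq_neg_of_add_eq_zero_left this
            have h1 : 1 < h := by omega
            have : Fact (1 < h) := ⟨h1⟩
            rw [ZMod.val_add_of_lt] <;> rw [ZMod.val_one]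
            exact hlt
          rw [h0]
          simp
    _ = _ := by simp

variable [MeasurableSpace X] {μ : Measure X} [VAddInvariantMeasure ℝ X μ]

theorem measureReal_vadd (t : ℝ) (A : Set X) : μ.real (t +ᵥ A) = μ.real A := by
  rw [measureReal_def, measure_vadd, measureReal_def]

theorem measureReal_towerLevel (E : Set X) (s : ℝ) (n : ℕ) :
    μ.real (towerLevel E s n) = μ.real E :=
  measureReal_vadd _ _

theorem measureReal_symmDiff_towerLevel_add (E : Set X) (s : ℝ) (h n : ℕ) :
    μ.real (symmDiff (towerLevel E s (n + h)) (towerLevel E s n))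
      = μ.real (symmDiff (towerLevel E s h) E) := by
  have : symmDiff (towerLevel E s (n + h)) (towerLevel E s n)
      = ((n : ℝ) * s) +ᵥ symmDiff (towerLevel E s h) E := by
    rw [Set.vadd_set_symmDiff, vadd_towerLevel, add_comm h n]
    rfl
  rw [this, measureReal_vadd]

/-- Adding heights modulo `h` moves a level by at most the roof error `μ (T_s^h E ∆ E)`. -/
theorem measureReal_symmDiff_towerLevel_val_add_le {h : ℕ} [NeZero h] (E : Set X) (s : ℝ)
    (i k : ZMod h) :
    μ.real (symmDiff (towerLevel E s (i.val + k.val)) (towerLevel E s (i + k).val))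
      ≤ μ.real (symmDiff (towerLevel E s h) E) := by
  rcases lt_or_ge (i.val + k.val) h with hlt | hge
  · rw [ZMod.val_add_of_lt hlt]
    simp
  · rw [← measureReal_symmDiff_towerLevel_add E s h (i + k).val, ZMod.val_add_val_of_le hge]

end Levels

/-! ### Measures of rectangles and marginals -/

section Marginals

variable {X : Type*} [MeasurableSpace X]

theorem abs_measureReal_prod_sub_le {Y : Type*} [MeasurableSpace Y] (ν : Measure (X × Y))
    [IsFiniteMeasure ν] (A A' : Set X) (B B' : Set Y) :
    |ν.real (A ×ˢ B) - ν.real (A' ×ˢ B')|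
      ≤ ν.real (symmDiff A A' ×ˢ B') + ν.real (A ×ˢ symmDiff B B') := by
  have h1 : A ×ˢ B ⊆ A' ×ˢ B' ∪ (symmDiff A A' ×ˢ B' ∪ A ×ˢ symmDiff B B') := by
    rintro ⟨x, y⟩ ⟨hx, hy⟩
    by_cases hx' : x ∈ A' <;> by_cases hy' : y ∈ B' <;>
      simp_all [Set.mem_symmDiff]
  have h2 : A' ×ˢ B' ⊆ A ×ˢ B ∪ (symmDiff A A' ×ˢ B' ∪ A ×ˢ symmDiff B B') := by
    rintro ⟨x, y⟩ ⟨hx, hy⟩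
    by_cases hx' : x ∈ A <;> by_cases hy' : y ∈ B <;>
      simp_all [Set.mem_symmDiff]
  have h3 := measureReal_union_le (μ := ν) (symmDiff A A' ×ˢ B') (A ×ˢ symmDiff B B')
  rw [abs_le]
  constructor
  · have := (measureReal_mono (μ := ν) h2).trans (measureReal_union_le _ _)
    linarith
  · have := (measureReal_mono (μ := ν) h1).trans (measureReal_union_le _ _)
    linarith

theorem measureReal_prod_univ {ν : Measure (X × X)} {μ : Measure X} (hν : ν.fst = μ)
    {A : Set X} (hA : MeasurableSet A) : ν.real (A ×ˢ univ) = μ.real A := by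
  rw [← hν, measureReal_def, measureReal_def, Measure.fst_apply hA, Set.prod_univ]

theorem measureReal_univ_prod {ν : Measure (X × X)} {μ : Measure X} (hν : ν.snd = μ)
    {B : Set X} (hB : MeasurableSet B) : ν.real (univ ×ˢ B) = μ.real B := by
  rw [← hν, measureReal_def, measureReal_def, Measure.snd_apply hB, Set.univ_prod]

theorem sum_measureReal_prod_le_fst {ι : Type*} [Fintype ι] {ν : Measure (X × X)}
    [IsFiniteMeasure ν] {μ : Measure X} (hν : ν.fst = μ) {A : Set X} (hA : MeasurableSet A) {B : ι → Set X}
    (hB : ∀ l, MeasurableSet (B l)) (hd : Pairwise (Function.onFun Disjoint B)) :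
    ∑ l, ν.real (A ×ˢ B l) ≤ μ.real A := by
  rw [← measureReal_biUnion_finset (fun l _ m _ hlm => (hd hlm).set_prod_right A A)
    (fun l _ => hA.prod (hB l)), ← measureReal_prod_univ hν hA]
  refine measureReal_mono (iUnion₂_subset fun l _ => ?_)
  exact prod_mono_right (subset_univ _)

theorem sum_measureReal_prod_le_snd {ι : Type*} [Fintype ι] {ν : Measure (X × X)}
    [IsFiniteMeasure ν] {μ : Measure X} (hν : ν.snd = μ) {A : ι → Set X} (hA : ∀ i, MeasurableSet (A i))
    (hd : Pairwise (Function.onFun Disjoint A)) {B : Set X} (hB : MeasurableSet B) :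
    ∑ i, ν.real (A i ×ˢ B) ≤ μ.real B := by
  rw [← measureReal_biUnion_finset (fun l _ m _ hlm => (hd hlm).set_prod_left B B)
    (fun i _ => (hA i).prod hB), ← measureReal_univ_prod hν hB]
  refine measureReal_mono (iUnion₂_subset fun l _ => ?_)
  exact prod_mono_left (subset_univ _)

theorem sum_sum_measureReal_prod_le_one {ι : Type*} [Fintype ι] {μ : Measure X}
    [IsProbabilityMeasure μ] {ν : Measure (X × X)}
    [IsFiniteMeasure ν] (hfst : ν.fst = μ) {A : ι → Set X} (hA : ∀ i, MeasurableSet (A i))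
    (hd : Pairwise (Function.onFun Disjoint A)) :
    ∑ i, ∑ l, ν.real (A i ×ˢ A l) ≤ 1 :=
  calc ∑ i, ∑ l, ν.real (A i ×ˢ A l) ≤ ∑ i, μ.real (A i) :=
        Finset.sum_le_sum fun i _ => sum_measureReal_prod_le_fst hfst (hA i) hA hd
    _ = μ.real (⋃ i ∈ Finset.univ, A i) :=
        (measureReal_biUnion_finset (fun l _ m _ hlm => hd hlm) fun i _ => hA i).symm
    _ ≤ 1 := measureReal_le_one

theorem measureReal_biUnion_prod_biUnion {ι : Type*} {ν : Measure (X × X)}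
    [IsFiniteMeasure ν] {A : ι → Set X} (hA : ∀ i, MeasurableSet (A i))
    (hd : Pairwise (Function.onFun Disjoint A)) (I J : Finset ι) :
    ν.real ((⋃ i ∈ I, A i) ×ˢ (⋃ l ∈ J, A l)) = ∑ i ∈ I, ∑ l ∈ J, ν.real (A i ×ˢ A l) := by
  have h1 : (⋃ i ∈ I, A i) ×ˢ (⋃ l ∈ J, A l) = ⋃ i ∈ I, ⋃ l ∈ J, A i ×ˢ A l := by
    ext ⟨x, y⟩
    simp only [mem_prod, mem_iUnion, exists_prop]
    tauto
  rw [h1, measureReal_biUnion_finset (h := fun _ _ => measure_ne_top _ _)]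
  · refine Finset.sum_congr rfl fun i _ => ?_
    exact measureReal_biUnion_finset (fun l _ m _ hlm => (hd hlm).set_prod_right _ _)
      fun l _ => (hA i).prod (hA l)
  · intro i _ m _ him
    simp only [Function.onFun, disjoint_iUnion_left, disjoint_iUnion_right]
    exact fun _ _ _ _ => (hd him).set_prod_left _ _
  · exact fun i _ => Finset.measurableSet_biUnion _ fun l _ => (hA i).prod (hA l)

end Marginals

/-! ### Self-joinings restricted to a tower -/

section Joining

variable {X : Type*} [MeasurableSpace X] [AddAction ℝ X] [MeasurableVAdd₂ ℝ X]

theorem measurableConstVAdd_prod : MeasurableConstVAdd ℝ (X × X) :=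
  ⟨fun c => ((measurable_const_vadd c).comp measurable_fst).prodMk
    ((measurable_const_vadd c).comp measurable_snd)⟩

theorem offDiagonal_real_prod {μ : ProbabilityMeasure X} (t : ℝ) {A B : Set X}
    (hA : MeasurableSet A) (hB : MeasurableSet B) :
    (offDiagonal μ t : Measure (X × X)).real (A ×ˢ B) = (μ : Measure X).real (A ∩ (t +ᵥ B)) := by
  have hm : Measurable fun x : X => (x, (-t) +ᵥ x) :=
    measurable_id.prodMk (measurable_const_vadd (-t))
  rw [measureReal_def, measureReal_def, offDiagonal, ProbabilityMeasure.toMeasure_map,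
    Measure.map_apply hm (hA.prod hB)]
  congr 2
  ext x
  simp [Set.mem_vadd_set_iff_neg_vadd_mem]

theorem isSelfJoining_offDiagonal (μ : ProbabilityMeasure X)
    [VAddInvariantMeasure ℝ X (μ : Measure X)] (t : ℝ) : IsSelfJoining μ (offDiagonal μ t) := by
  have hm : Measurable fun x : X => (x, (-t) +ᵥ x) :=
    measurable_id.prodMk (measurable_const_vadd (-t))
  have hc : (offDiagonal μ t : Measure (X × X)) = (μ : Measure X).map fun x => (x, (-t) +ᵥ x) :=
    ProbabilityMeasure.toMeasure_map _ _
  refine ⟨?_, ?_, ⟨fun c s hs => ?_⟩⟩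
  · rw [hc, Measure.fst, Measure.map_map measurable_fst hm]
    exact Measure.map_id
  · rw [hc, Measure.snd, Measure.map_map measurable_snd hm]
    exact (measurePreserving_vadd (-t) (μ : Measure X)).map_eq
  · have hs' : MeasurableSet ((fun x : X × X => c +ᵥ x) ⁻¹' s) :=
      measurableConstVAdd_prod.measurable_const_vadd c hs
    rw [hc, Measure.map_apply hm hs', Measure.map_apply hm hs,
      ← measure_preimage_vadd (μ : Measure X) c (_ ⁻¹' s)]
    congr 1
    ext x
    simp only [mem_preimage]
    have : c +ᵥ (x, -t +ᵥ x) = (c +ᵥ x, -t +ᵥ (c +ᵥ x)) := by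
      rw [vadd_comm (-t) c x]
      rfl
    rw [this]

/-- Invariance under `T_s × T_s` makes the matrix of a joining on the cells of a tower almost
constant along the cyclic diagonals; only the cells on top of the tower contribute an error. -/
theorem sum_abs_measureReal_prod_towerLevel_sub_le {μ : Measure X} [VAddInvariantMeasure ℝ X μ]
    {ν : Measure (X × X)} [IsFiniteMeasure ν] [VAddInvariantMeasure ℝ (X × X) ν]
    (hfst : ν.fst = μ) (hsnd : ν.snd = μ) {E : Set X} (hE : MeasurableSet E) (s : ℝ) {h : ℕ}
    [NeZero h]
    (hd : Pairwise (Function.onFun Disjoint fun i : ZMod h => towerLevel E s i.val)) :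
    ∑ i : ZMod h, ∑ l : ZMod h,
      |ν.real (towerLevel E s (i + 1).val ×ˢ towerLevel E s (l + 1).val)
        - ν.real (towerLevel E s i.val ×ˢ towerLevel E s l.val)|
      ≤ 2 * μ.real (symmDiff (towerLevel E s h) E) := by
  have hL : ∀ n, MeasurableSet (towerLevel E s n) := fun n => hE.towerLevel s n
  have hshift : ∀ i l : ℕ, ν.real (towerLevel E s i ×ˢ towerLevel E s l)
      = ν.real (towerLevel E s (i + 1) ×ˢ towerLevel E s (l + 1)) := by
    intro i l
    rw [← vadd_towerLevel E s 1 i, ← vadd_towerLevel E s 1 l, ← measureReal_vadd (((1 : ℕ) : ℝ) * s)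
      (towerLevel E s i ×ˢ towerLevel E s l)]
    congr 1
    ext ⟨x, y⟩
    simp [Set.mem_vadd_set_iff_neg_vadd_mem]
  have hd1 : Pairwise (Function.onFun Disjoint fun i : ZMod h => towerLevel E s (i.val + 1)) := by
    intro i l hil
    have := hd hil
    simp only [Function.onFun] at this ⊢
    rw [← vadd_towerLevel E s 1, ← vadd_towerLevel E s 1]
    exact Set.disjoint_vadd_set.2 this
  have hd2 : Pairwise (Function.onFun Disjoint fun i : ZMod h => towerLevel E s (i + 1).val) :=
    fun i l hil => hd fun h => hil (add_right_cancel h)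
  have hS : ∀ i : ZMod h, MeasurableSet
      (symmDiff (towerLevel E s (i + 1).val) (towerLevel E s (i.val + 1))) :=
    fun i => (hL _).symmDiff (hL _)
  calc _ ≤ ∑ i : ZMod h, ∑ l : ZMod h,
        (ν.real (symmDiff (towerLevel E s (i + 1).val) (towerLevel E s (i.val + 1))
            ×ˢ towerLevel E s (l.val + 1))
          + ν.real (towerLevel E s (i + 1).val
            ×ˢ symmDiff (towerLevel E s (l + 1).val) (towerLevel E s (l.val + 1)))) := by
        refine Finset.sum_le_sum fun i _ => Finset.sum_le_sum fun l _ => ?_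
        rw [hshift i.val l.val]
        exact abs_measureReal_prod_sub_le ν _ _ _ _
    _ = ∑ i : ZMod h, ∑ l : ZMod h,
        ν.real (symmDiff (towerLevel E s (i + 1).val) (towerLevel E s (i.val + 1))
            ×ˢ towerLevel E s (l.val + 1))
        + ∑ l : ZMod h, ∑ i : ZMod h, ν.real (towerLevel E s (i + 1).val
            ×ˢ symmDiff (towerLevel E s (l + 1).val) (towerLevel E s (l.val + 1))) := by
        simp only [Finset.sum_add_distrib]
        congr 1
        exact Finset.sum_comm
    _ ≤ ∑ i : ZMod h, μ.real (symmDiff (towerLevel E s (i + 1).val) (towerLevel E s (i.val + 1)))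
        + ∑ l : ZMod h,
          μ.real (symmDiff (towerLevel E s (l + 1).val) (towerLevel E s (l.val + 1))) :=
        add_le_add
          (Finset.sum_le_sum fun i _ =>
            sum_measureReal_prod_le_fst hfst (hS i) (fun l => hL _) hd1)
          (Finset.sum_le_sum fun l _ =>
            sum_measureReal_prod_le_snd hsnd (fun i => hL _) hd2 (hS l))
    _ ≤ _ := by
        have := sum_measureReal_symmDiff_towerLevel_le (μ := μ) (h := h) E s
        linarith

/-- The mass which `ν` gives to the `k`-th cyclic diagonal of the product of a tower of height `h`
with itself. -/
noncomputable def diagonalWeight (ν : Measure (X × X)) (E : Set X) (s : ℝ) (h : ℕ) [NeZero h]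
    (k : ZMod h) : ℝ :=
  ∑ m : ZMod h, ν.real (towerLevel E s m.val ×ˢ towerLevel E s (m + k).val)

/-- The off-diagonal joining carried, up to the top of the tower, by the `k`-th cyclic diagonal. -/
noncomputable def diagonalJoining (μ : ProbabilityMeasure X) (s : ℝ) {h : ℕ} (k : ZMod h) :
    ProbabilityMeasure (X × X) :=
  offDiagonal μ (((-(k.val : ℤ) : ℤ) : ℝ) * s)

/-- On products of unions of levels, a self-joining is a mixture of off-diagonal joinings, up to
an error controlled by the roof and by the complement of the tower. -/
theorem abs_measureReal_prod_sub_sum_diagonalWeight_mul_le {μ : ProbabilityMeasure X}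
    [VAddInvariantMeasure ℝ X (μ : Measure X)] {ν : ProbabilityMeasure (X × X)}
    (hν : IsSelfJoining μ ν) {E : Set X} (hE : MeasurableSet E) (s : ℝ) {h : ℕ} [NeZero h]
    (hd : Pairwise (Function.onFun Disjoint fun i : ZMod h => towerLevel E s i.val))
    (I J : Finset (ZMod h)) :
    |(ν : Measure (X × X)).real
        ((⋃ i ∈ I, towerLevel E s i.val) ×ˢ (⋃ l ∈ J, towerLevel E s l.val))
      - ∑ k, diagonalWeight (ν : Measure (X × X)) E s h k *
        (diagonalJoining μ s k : Measure (X × X)).real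
          ((⋃ i ∈ I, towerLevel E s i.val) ×ˢ (⋃ l ∈ J, towerLevel E s l.val))|
      ≤ 4 * (h * (μ : Measure X).real (symmDiff (towerLevel E s h) E))
        + 2 * (1 - h * (μ : Measure X).real E) := by
  have := hν.invariant
  have hL : ∀ i : ZMod h, MeasurableSet (towerLevel E s i.val) := fun i => hE.towerLevel s _
  simp only [measureReal_biUnion_prod_biUnion hL hd, diagonalWeight]
  refine abs_sum_sub_sum_diagonal_weight_le
    (b := fun k i l => (diagonalJoining μ s k : Measure (X × X)).real
      (towerLevel E s i.val ×ˢ towerLevel E s l.val))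
    (fun _ _ => measureReal_nonneg)
    (sum_sum_measureReal_prod_le_one hν.fst_eq hL hd)
    (sum_abs_measureReal_prod_towerLevel_sub_le hν.fst_eq hν.snd_eq hE s hd) ?_
    measureReal_nonneg (fun _ _ _ => measureReal_nonneg)
    (fun k => sum_sum_measureReal_prod_le_one (isSelfJoining_offDiagonal μ _).fst_eq hL hd) ?_ I J
  · calc (h : ℝ) * (μ : Measure X).real E
        = ∑ i : ZMod h, (μ : Measure X).real (towerLevel E s i.val) := by
          simp [measureReal_towerLevel]
      _ = (μ : Measure X).real (⋃ i ∈ Finset.univ, towerLevel E s (ZMod.val (n := h) i)) :=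
          (measureReal_biUnion_finset (fun l _ m _ hlm => hd hlm) fun i _ => hL i).symm
      _ ≤ 1 := measureReal_le_one
  -- after translation by `k s` this is the overlap of the levels `i + k` with and without reduction
  · intro k i
    rw [diagonalJoining, offDiagonal_real_prod _ (hL _) (hL _), ← measureReal_vadd (k.val * s)
      (towerLevel E s i.val ∩ _),
      Set.vadd_set_inter, vadd_vadd, vadd_towerLevel]
    have h0 : (k.val : ℝ) * s + ((-(k.val : ℤ) : ℤ) : ℝ) * s = 0 := by
      push_cast
      ring
    rw [h0, zero_vadd]
    have h1 := measureReal_symmDiff_towerLevel_val_add_le (μ := (μ : Measure X)) E s i k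
    have h2 : towerLevel E s (i + k).val
        ⊆ towerLevel E s (i.val + k.val) ∩ towerLevel E s (i + k).val
          ∪ symmDiff (towerLevel E s (i.val + k.val)) (towerLevel E s (i + k).val) := by
      intro x hx
      by_cases hx' : x ∈ towerLevel E s (i.val + k.val) <;> simp [hx, hx', Set.mem_symmDiff]
    have h3 := (measureReal_mono (μ := (μ : Measure X)) h2).trans (measureReal_union_le _ _)
    rw [measureReal_towerLevel] at h3
    linarith

end Joining

/-! ### Rank-one towers fill the space -/

/-- An atomless measure admits countable measurable covers by sets of arbitrarily small measure. -/
theorem exists_seq_measurableSet_iUnion_eq_univ {X : Type*} [TopologicalSpace X] [PolishSpace X]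
    [MeasurableSpace X] [BorelSpace X] (μ : Measure X) [IsProbabilityMeasure μ]
    [NullSingletonClass μ] {ε : ℝ} (hε : 0 < ε) :
    ∃ U : ℕ → Set X, (∀ n, MeasurableSet (U n)) ∧ (∀ n, μ.real (U n) < ε) ∧ ⋃ n, U n = univ := by
  have h1 : ∀ x : X, ∃ U ⊇ {x}, IsOpen U ∧ μ U < ENNReal.ofReal ε := fun x =>
    Set.exists_isOpen_lt_of_lt {x} _ (by rw [measure_singleton]; exact ENNReal.ofReal_pos.2 hε)
  choose f hxf hfo hfμ using h1
  obtain ⟨t, htc, ht⟩ := TopologicalSpace.countable_cover_nhds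
    (f := f) fun x => (hfo x).mem_nhds (hxf x rfl)
  have hne : t.Nonempty := by
    rw [nonempty_iff_ne_empty]
    rintro rfl
    have : (univ : Set X).Nonempty := nonempty_of_measure_ne_zero (μ := μ) (by simp)
    rw [← ht] at this
    simp at this
  obtain ⟨u, rfl⟩ := htc.exists_eq_range hne
  refine ⟨fun n => f (u n), fun n => (hfo _).measurableSet, fun n => ?_, by simpa using ht⟩
  exact (ENNReal.lt_ofReal_iff_toReal_lt (measure_ne_top _ _)).1 (hfμ (u n))

section Tower

variable {X : Type*} [AddAction ℝ X]

theorem tower_eq_iUnion_towerLevel (E : Set X) (s : ℝ) (h : ℕ) [NeZero h] :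
    tower E s h = ⋃ i ∈ (Finset.univ : Finset (ZMod h)), towerLevel E s i.val := by
  ext x
  simp only [tower, mem_iUnion, Finset.mem_range, Finset.mem_univ, exists_prop, true_and]
  constructor
  · rintro ⟨i, hi, hx⟩
    refine ⟨(i : ZMod h), ?_⟩
    rwa [ZMod.val_natCast_of_lt hi]
  · rintro ⟨i, hx⟩
    exact ⟨i.val, ZMod.val_lt i, hx⟩

theorem IsPartitionMeasurable.compl_tower_subset_or_disjoint {E : Set X} {s : ℝ} {h : ℕ}
    {A : Set X} (hA : IsPartitionMeasurable (towerPartition E s h) A) :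
    (tower E s h)ᶜ ⊆ A ∨ Disjoint (tower E s h)ᶜ A := by
  obtain ⟨F, hF, rfl⟩ := hA
  by_cases hR : (tower E s h)ᶜ ∈ F
  · exact Or.inl (subset_sUnion_of_mem hR)
  · refine Or.inr (disjoint_sUnion_right.2 fun B hB => ?_)
    rcases hF hB with rfl | ⟨i, hi, rfl⟩
    · exact absurd hB hR
    · rw [disjoint_compl_left_iff_subset]
      exact subset_iUnion₂_of_subset i (Finset.mem_range.2 hi) subset_rfl

theorem IsPartitionMeasurable.exists_finset_towerLevel {E : Set X} {s : ℝ} {h : ℕ} [NeZero h]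
    {A : Set X} (hA : IsPartitionMeasurable (towerPartition E s h) A) :
    ∃ I : Finset (ZMod h), symmDiff A (⋃ i ∈ I, towerLevel E s i.val) ⊆ (tower E s h)ᶜ := by
  classical
  obtain ⟨F, hF, rfl⟩ := hA
  refine ⟨Finset.univ.filter fun i => towerLevel E s i.val ∈ F, ?_⟩
  rintro x (⟨⟨B, hB, hx⟩, hx'⟩ | ⟨hx, hx'⟩)
  · rcases hF hB with rfl | ⟨i, hi, rfl⟩
    · exact hx
    · refine absurd ?_ hx'
      refine mem_iUnion₂.2 ⟨(i : ZMod h), ?_, ?_⟩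
      · rw [Finset.mem_filter, ZMod.val_natCast_of_lt hi]
        exact ⟨Finset.mem_univ _, hB⟩
      · rwa [ZMod.val_natCast_of_lt hi]
  · obtain ⟨i, hi, hxi⟩ := mem_iUnion₂.1 hx
    exact absurd ⟨_, (Finset.mem_filter.1 hi).2, hxi⟩ hx'

variable [MeasurableSpace X]

theorem IsRankOneSequence.pairwise_disjoint_towerLevel {μ : Measure X} {E : ℕ → Set X} {s : ℕ → ℝ}
    {h : ℕ → ℕ} (hr : IsRankOneSequence μ E s h) (j : ℕ) [NeZero (h j)] :
    Pairwise (Function.onFun Disjoint fun i : ZMod (h j) => towerLevel (E j) (s j) i.val) :=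
  fun i l hil => hr.disjoint_levels j _ (ZMod.val_lt i) _ (ZMod.val_lt l)
    fun hv => hil (ZMod.val_injective _ hv)

/-- The towers of a rank-one sequence exhaust the space. A set of measure less than `ε / 2` that is
well approximated by a union of atoms of `ξ_j` either has an approximant avoiding the remainder `R`
of the tower, so that it hardly meets `R`, or almost contains `R`, so that `R` is small; finitely
many such sets cover most of the space. -/
theorem IsRankOneSequence.tendsto_measureReal_compl_tower [TopologicalSpace X] [PolishSpace X]
    [BorelSpace X] {μ : Measure X} [IsProbabilityMeasure μ] [NullSingletonClass μ]
    {E : ℕ → Set X} {s : ℕ → ℝ} {h : ℕ → ℕ} (hr : IsRankOneSequence μ E s h) :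
    Tendsto (fun j => μ.real (tower (E j) (s j) (h j))ᶜ) atTop (𝓝 0) := by
  refine tendsto_order.2 ⟨fun a ha => Eventually.of_forall fun j =>
    ha.trans_le measureReal_nonneg, fun ε hε => ?_⟩
  obtain ⟨U, hUm, hUμ, hU⟩ := exists_seq_measurableSet_iUnion_eq_univ μ (half_pos hε)
  choose A hAp hA using fun n => hr.converges (U n) (hUm n)
  have hAr : ∀ n, Tendsto (fun j => μ.real (symmDiff (U n) (A n j))) atTop (𝓝 0) := fun n =>
    (ENNReal.tendsto_toReal_zero_iff fun _ => measure_ne_top _ _).2 (hA n)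
  have hrest : Tendsto (fun N => μ.real (⋃ n, ⋃ (_ : n < N), U n)ᶜ) atTop (𝓝 0) := by
    have hmono : Antitone fun N => (⋃ n, ⋃ (_ : n < N), U n)ᶜ := fun M N hMN =>
      compl_subset_compl.2 (iUnion₂_subset fun n hn =>
        subset_iUnion₂_of_subset n (lt_of_lt_of_le hn hMN) subset_rfl)
    have h1 := tendsto_measure_iInter_atTop (μ := μ) (s := fun N => (⋃ n, ⋃ (_ : n < N), U n)ᶜ)
      (fun N => (MeasurableSet.iUnion fun n => MeasurableSet.iUnion fun _ =>
        hUm n).compl.nullMeasurableSet) hmono ⟨0, measure_ne_top _ _⟩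
    have h2 : ⋂ N, (⋃ n, ⋃ (_ : n < N), U n)ᶜ = ∅ := by
      refine eq_empty_of_forall_notMem fun x hx => ?_
      obtain ⟨n, hn⟩ := mem_iUnion.1 (hU ▸ mem_univ x : x ∈ ⋃ n, U n)
      exact mem_iInter.1 hx (n + 1) (mem_iUnion₂.2 ⟨n, n.lt_succ_self, hn⟩)
    rw [h2, measure_empty] at h1
    exact (ENNReal.tendsto_toReal_zero_iff fun _ => measure_ne_top _ _).2 h1
  obtain ⟨N, hN⟩ := (hrest.eventually_lt_const (show (0 : ℝ) < ε / 4 by positivity)).exists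
  have hfin : Tendsto (fun j => ∑ n ∈ Finset.range N, μ.real (symmDiff (U n) (A n j))) atTop
      (𝓝 0) := by
    simpa using tendsto_finsetSum (Finset.range N) fun n _ => hAr n
  filter_upwards [hfin.eventually_lt_const (show (0 : ℝ) < ε / 4 by positivity)] with j hj
  set R := (tower (E j) (s j) (h j))ᶜ
  by_cases hR : ∃ n ∈ Finset.range N, R ⊆ A n j
  · obtain ⟨n, hn, hsub⟩ := hR
    have h1 : R ⊆ U n ∪ symmDiff (U n) (A n j) := fun x hx => by
      by_cases hxU : x ∈ U n <;> simp [hxU, hsub hx, Set.mem_symmDiff]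
    have h2 := (measureReal_mono (μ := μ) h1).trans (measureReal_union_le _ _)
    have h3 := Finset.single_le_sum
      (f := fun n => μ.real (symmDiff (U n) (A n j))) (fun _ _ => measureReal_nonneg) hn
    have h4 := hUμ n
    linarith
  · push Not at hR
    have h1 : R ⊆ (⋃ n ∈ Finset.range N, symmDiff (U n) (A n j)) ∪ (⋃ n, ⋃ (_ : n < N), U n)ᶜ := by
      intro x hx
      by_cases hxU : x ∈ ⋃ n, ⋃ (_ : n < N), U n
      · obtain ⟨n, hn, hxn⟩ := mem_iUnion₂.1 hxU
        have hd := (hAp n j).compl_tower_subset_or_disjoint.resolve_left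
          (hR n (Finset.mem_range.2 hn))
        refine Or.inl (mem_iUnion₂.2 ⟨n, Finset.mem_range.2 hn, Or.inl ⟨hxn, ?_⟩⟩)
        exact disjoint_left.1 hd hx
      · exact Or.inr hxU
    have h2 := (measureReal_mono (μ := μ) h1).trans (measureReal_union_le _ _)
    have h3 := measureReal_biUnion_finset_le (μ := μ) (Finset.range N)
      fun n => symmDiff (U n) (A n j)
    linarith

theorem IsRankOneSequence.exists_finset_tendsto_measureReal_symmDiff [TopologicalSpace X]
    [PolishSpace X]
    [BorelSpace X] {μ : Measure X} [IsProbabilityMeasure μ] [NullSingletonClass μ]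
    {E : ℕ → Set X} {s : ℕ → ℝ} {h : ℕ → ℕ} [∀ j, NeZero (h j)] (hr : IsRankOneSequence μ E s h)
    {A : Set X} (hA : MeasurableSet A) :
    ∃ I : ∀ j, Finset (ZMod (h j)),
      Tendsto (fun j => μ.real (symmDiff A (⋃ i ∈ I j, towerLevel (E j) (s j) i.val))) atTop
        (𝓝 0) := by
  obtain ⟨A', hA'p, hA'⟩ := hr.converges A hA
  choose I hI using fun j => (hA'p j).exists_finset_towerLevel
  refine ⟨I, ?_⟩
  have h1 : Tendsto (fun j => μ.real (symmDiff A (A' j)) + μ.real (tower (E j) (s j) (h j))ᶜ)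
      atTop (𝓝 0) := by
    have h0 : Tendsto (fun j => μ.real (symmDiff A (A' j))) atTop (𝓝 0) :=
      (ENNReal.tendsto_toReal_zero_iff fun _ => measure_ne_top _ _).2 hA'
    simpa using h0.add hr.tendsto_measureReal_compl_tower
  refine squeeze_zero (fun _ => measureReal_nonneg) (fun j => ?_) h1
  calc _ ≤ μ.real (symmDiff A (A' j)
          ∪ symmDiff (A' j) (⋃ i ∈ I j, towerLevel (E j) (s j) i.val)) :=
        measureReal_mono (symmDiff_triangle _ _ _)
    _ ≤ _ := (measureReal_union_le _ _).trans
        (add_le_add_right (measureReal_mono (hI j)) _)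

theorem IsSelfJoining.abs_measureReal_prod_sub_le_marginals {μ : ProbabilityMeasure X}
    {ρ : ProbabilityMeasure (X × X)} (hρ : IsSelfJoining μ ρ) {A A' B B' : Set X}
    (hA : MeasurableSet A) (hA' : MeasurableSet A') (hB : MeasurableSet B)
    (hB' : MeasurableSet B') :
    |(ρ : Measure (X × X)).real (A ×ˢ B) - (ρ : Measure (X × X)).real (A' ×ˢ B')|
      ≤ (μ : Measure X).real (symmDiff A A') + (μ : Measure X).real (symmDiff B B') := by
  refine (abs_measureReal_prod_sub_le _ _ _ _ _).trans (add_le_add ?_ ?_)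
  · rw [← measureReal_prod_univ hρ.fst_eq (hA.symmDiff hA')]
    exact measureReal_mono (prod_mono_right (subset_univ _))
  · rw [← measureReal_univ_prod hρ.snd_eq (hB.symmDiff hB')]
    exact measureReal_mono (prod_mono_left (subset_univ _))

theorem diagonalWeight_nonneg (ν : Measure (X × X)) (E : Set X) (s : ℝ) (h : ℕ) [NeZero h]
    (k : ZMod h) : 0 ≤ diagonalWeight ν E s h k :=
  Finset.sum_nonneg fun _ _ => measureReal_nonneg

variable [MeasurableVAdd₂ ℝ X]

theorem IsRankOneSequence.measureReal_compl_tower {μ : Measure X} [IsProbabilityMeasure μ]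
    [VAddInvariantMeasure ℝ X μ] {E : ℕ → Set X} {s : ℕ → ℝ} {h : ℕ → ℕ}
    (hr : IsRankOneSequence μ E s h) (j : ℕ) [NeZero (h j)] :
    μ.real (tower (E j) (s j) (h j))ᶜ = 1 - h j * μ.real (E j) := by
  have hL : ∀ i : ZMod (h j), MeasurableSet (towerLevel (E j) (s j) i.val) :=
    fun i => (hr.measurableSet_base j).towerLevel _ _
  rw [tower_eq_iUnion_towerLevel, probReal_compl_eq_one_sub
    (Finset.measurableSet_biUnion _ fun i _ => hL i), measureReal_biUnion_finset
    (fun l _ m _ hlm => hr.pairwise_disjoint_towerLevel j hlm) fun i _ => hL i]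
  simp [measureReal_towerLevel]

/-- The flat roof condition, multiplied by `h_j μ (E_j) ≤ 1`. If `μ (E_j) = 0`, both sides of the
comparison vanish, the right one because of division by zero. -/
theorem IsFlatRoofSequence.tendsto_height_mul_measureReal_symmDiff {μ : Measure X}
    [IsProbabilityMeasure μ]
    [VAddInvariantMeasure ℝ X μ] {E : ℕ → Set X} {s : ℕ → ℝ} {h : ℕ → ℕ}
    (hr : IsFlatRoofSequence μ E s h) :
    Tendsto (fun j => h j * μ.real (symmDiff (towerLevel (E j) (s j) (h j)) (E j))) atTop
      (𝓝 0) := by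
  refine squeeze_zero (fun j => by positivity) (fun j => ?_) hr.flat_roof
  have : NeZero (h j) := ⟨(hr.height_pos j).ne'⟩
  have h1 := hr.measureReal_compl_tower j
  have h2 : (h j : ℝ) * μ.real (E j) ≤ 1 := by
    have := measureReal_nonneg (μ := μ) (s := (tower (E j) (s j) (h j))ᶜ)
    linarith
  change _ ≤ μ.real (symmDiff (towerLevel (E j) (s j) (h j)) (E j)) / μ.real (E j)
  set δ := μ.real (symmDiff (towerLevel (E j) (s j) (h j)) (E j)) with hδ
  have hδ0 : 0 ≤ δ := measureReal_nonneg
  rcases (measureReal_nonneg (μ := μ) (s := E j)).eq_or_lt with h0 | hpos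
  · have : δ ≤ 0 := by
      have h3 := measureReal_mono (μ := μ) (symmDiff_le_sup
        (a := towerLevel (E j) (s j) (h j)) (b := E j))
      have h4 := h3.trans (measureReal_union_le _ _)
      rw [measureReal_towerLevel, ← h0] at h4
      simpa using h4
    rw [le_antisymm this hδ0]
    simp
  · rw [le_div_iff₀ hpos]
    nlinarith

theorem sum_diagonalWeight_le_one {μ : ProbabilityMeasure X} {ν : ProbabilityMeasure (X × X)}
    (hν : IsSelfJoining μ ν) {E : Set X} (hE : MeasurableSet E) (s : ℝ) {h : ℕ} [NeZero h]
    (hd : Pairwise (Function.onFun Disjoint fun i : ZMod h => towerLevel E s i.val)) :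
    ∑ k, diagonalWeight (ν : Measure (X × X)) E s h k ≤ 1 := by
  refine le_trans (le_of_eq ?_) (sum_sum_measureReal_prod_le_one hν.fst_eq
    (fun i : ZMod h => hE.towerLevel s i.val) hd)
  simp only [diagonalWeight]
  rw [Finset.sum_comm]
  exact Finset.sum_congr rfl fun i _ => Fintype.sum_equiv (Equiv.addLeft i) _ _ fun _ => rfl

/-- Every self-joining is, on rectangles, the limit of mixtures of off-diagonal joinings. -/
theorem IsFlatRoofSequence.tendsto_sum_diagonalWeight_mul [TopologicalSpace X] [PolishSpace X]
    [BorelSpace X] {μ : ProbabilityMeasure X} [NullSingletonClass (μ : Measure X)]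
    [VAddInvariantMeasure ℝ X (μ : Measure X)] {E : ℕ → Set X} {s : ℕ → ℝ} {h : ℕ → ℕ}
    [∀ j, NeZero (h j)] (hr : IsFlatRoofSequence (μ : Measure X) E s h)
    {ν : ProbabilityMeasure (X × X)} (hν : IsSelfJoining μ ν) {A B : Set X}
    (hA : MeasurableSet A) (hB : MeasurableSet B) :
    Tendsto (fun j => ∑ k, diagonalWeight (ν : Measure (X × X)) (E j) (s j) (h j) k
      * (diagonalJoining μ (s j) k : Measure (X × X)).real (A ×ˢ B)) atTop
      (𝓝 ((ν : Measure (X × X)).real (A ×ˢ B))) := by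
  obtain ⟨I, hI⟩ := hr.exists_finset_tendsto_measureReal_symmDiff hA
  obtain ⟨J, hJ⟩ := hr.exists_finset_tendsto_measureReal_symmDiff hB
  have herr := ((hI.add hJ).const_mul 2).add
    ((hr.tendsto_height_mul_measureReal_symmDiff.const_mul 4).add
      (hr.tendsto_measureReal_compl_tower.const_mul 2))
  simp only [add_zero, mul_zero] at herr
  rw [tendsto_iff_norm_sub_tendsto_zero]
  refine squeeze_zero (fun _ => norm_nonneg _) (fun j => ?_) herr
  have hL : ∀ K : Finset (ZMod (h j)), MeasurableSet (⋃ i ∈ K, towerLevel (E j) (s j) i.val) :=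
    fun K => Finset.measurableSet_biUnion _ fun i _ => (hr.measurableSet_base j).towerLevel _ _
  have hd := hr.pairwise_disjoint_towerLevel j
  have h1 := abs_measureReal_prod_sub_sum_diagonalWeight_mul_le hν (hr.measurableSet_base j) (s j)
    hd (I j) (J j)
  have h2 := hν.abs_measureReal_prod_sub_le_marginals hA (hL (I j)) hB (hL (J j))
  have h3 : ∀ k : ZMod (h j), _ := fun k =>
    (isSelfJoining_offDiagonal μ (((-(k.val : ℤ) : ℤ) : ℝ) * s
      j)).abs_measureReal_prod_sub_le_marginals
      hA (hL (I j)) hB (hL (J j))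
  rw [← hr.measureReal_compl_tower j] at h1
  set A' := ⋃ i ∈ I j, towerLevel (E j) (s j) i.val
  set B' := ⋃ i ∈ J j, towerLevel (E j) (s j) i.val
  set w := diagonalWeight (ν : Measure (X × X)) (E j) (s j) (h j)
  set η := (μ : Measure X).real (symmDiff A A') + (μ : Measure X).real (symmDiff B B')
  have h4 : |∑ k, w k * (diagonalJoining μ (s j) k : Measure (X × X)).real (A ×ˢ B)
      - ∑ k, w k * (diagonalJoining μ (s j) k : Measure (X × X)).real (A' ×ˢ B')| ≤ η := by
    rw [← Finset.sum_sub_distrib]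
    calc _ ≤ ∑ k, w k * η := by
          refine (Finset.abs_sum_le_sum_abs _ _).trans (Finset.sum_le_sum fun k _ => ?_)
          rw [← mul_sub, abs_mul, abs_of_nonneg (diagonalWeight_nonneg _ _ _ _ _)]
          exact mul_le_mul_of_nonneg_left (h3 k) (diagonalWeight_nonneg _ _ _ _ _)
      _ ≤ η := by
          rw [← Finset.sum_mul]
          exact mul_le_of_le_one_left (add_nonneg measureReal_nonneg measureReal_nonneg)
            (sum_diagonalWeight_le_one hν (hr.measurableSet_base j) (s j) hd)
  rw [Real.norm_eq_abs]
  rw [abs_le] at h1 h2 h4 ⊢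
  constructor <;> linarith

end Tower

/-! ### The algebra generated by measurable rectangles -/

section Rectangles

variable {X Y : Type*} [MeasurableSpace X] [MeasurableSpace Y]

variable (X Y) in
/-- The indicator functions of measurable rectangles, as a multiplicative submonoid of the
functions on the product. -/
def rectangleIndicators : Submonoid (X × Y → ℝ) where
  carrier := {f | ∃ A B, MeasurableSet A ∧ MeasurableSet B ∧ f = (A ×ˢ B).indicator 1}
  one_mem' := ⟨univ, univ, .univ, .univ, by simp⟩
  mul_mem' := by
    rintro _ _ ⟨A, B, hA, hB, rfl⟩ ⟨A', B', hA', hB', rfl⟩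
    refine ⟨A ∩ A', B ∩ B', hA.inter hA', hB.inter hB', ?_⟩
    rw [← Set.prod_inter_prod, Set.inter_indicator_one]

variable (X Y) in
/-- The algebra of simple functions over measurable rectangles. -/
noncomputable def rectangleAlgebra : Subalgebra ℝ (X × Y → ℝ) :=
  Algebra.adjoin ℝ (rectangleIndicators X Y : Set (X × Y → ℝ))

theorem indicator_mem_rectangleAlgebra {A : Set X} {B : Set Y} (hA : MeasurableSet A)
    (hB : MeasurableSet B) : (A ×ˢ B).indicator 1 ∈ rectangleAlgebra X Y :=
  Algebra.subset_adjoin ⟨A, B, hA, hB, rfl⟩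

/-- A product of indicators of rectangles is again one, so that the algebra is spanned linearly by
these indicators. -/
theorem rectangleAlgebra_induction {p : (X × Y → ℝ) → Prop}
    (indicator : ∀ A B, MeasurableSet A → MeasurableSet B → p ((A ×ˢ B).indicator 1))
    (zero : p 0) (add : ∀ f g, p f → p g → p (f + g)) (smul : ∀ (c : ℝ) f, p f → p (c • f))
    {f : X × Y → ℝ} (hf : f ∈ rectangleAlgebra X Y) : p f := by
  have hf' : f ∈ Submodule.span ℝ (rectangleIndicators X Y : Set (X × Y → ℝ)) := by
    rw [rectangleAlgebra, ← Subalgebra.mem_toSubmodule, Algebra.adjoin_eq_span,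
      Submonoid.closure_eq] at hf
    exact hf
  clear hf
  induction hf' using Submodule.span_induction with
  | mem f h =>
    obtain ⟨A, B, hA, hB, rfl⟩ := h
    exact indicator A B hA hB
  | zero => exact zero
  | add f g _ _ h1 h2 => exact add f g h1 h2
  | smul c f _ h => exact smul c f h

theorem measurable_of_mem_rectangleAlgebra {f : X × Y → ℝ} (hf : f ∈ rectangleAlgebra X Y) :
    Measurable f :=
  rectangleAlgebra_induction (fun _ _ hA hB => measurable_one.indicator (hA.prod hB))
    measurable_zero (fun _ _ h1 h2 => h1.add h2) (fun c _ h => h.const_smul c) hf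

theorem exists_norm_le_of_mem_rectangleAlgebra {f : X × Y → ℝ} (hf : f ∈ rectangleAlgebra X Y) :
    ∃ C : ℝ, ∀ z, ‖f z‖ ≤ C := by
  refine rectangleAlgebra_induction (p := fun f => ∃ C : ℝ, ∀ z, ‖f z‖ ≤ C) ?_ ⟨0, by simp⟩ ?_ ?_ hf
  · intro A B _ _
    refine ⟨1, fun z => ?_⟩
    exact (norm_indicator_le_norm_self _ z).trans (by simp)
  · rintro f g ⟨C, hC⟩ ⟨C', hC'⟩
    exact ⟨C + C', fun z => (norm_add_le _ _).trans (add_le_add (hC z) (hC' z))⟩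
  · rintro c f ⟨C, hC⟩
    refine ⟨‖c‖ * C, fun z => ?_⟩
    rw [Pi.smul_apply, norm_smul]
    exact mul_le_mul_of_nonneg_left (hC z) (norm_nonneg c)

theorem integrable_of_mem_rectangleAlgebra {f : X × Y → ℝ} (hf : f ∈ rectangleAlgebra X Y)
    (ρ : Measure (X × Y)) [IsFiniteMeasure ρ] : Integrable f ρ := by
  obtain ⟨C, hC⟩ := exists_norm_le_of_mem_rectangleAlgebra hf
  exact .of_bound (measurable_of_mem_rectangleAlgebra hf).aestronglyMeasurable C (ae_of_all _ hC)

theorem comp_vadd_mem_rectangleAlgebra {G : Type*} [VAdd G X] [VAdd G Y] [MeasurableConstVAdd G X]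
    [MeasurableConstVAdd G Y] {f : X × Y → ℝ} (hf : f ∈ rectangleAlgebra X Y) (g : G) :
    (fun z => f (g +ᵥ z)) ∈ rectangleAlgebra X Y := by
  refine rectangleAlgebra_induction
    (p := fun f => (fun z => f (g +ᵥ z)) ∈ rectangleAlgebra X Y) ?_ (zero_mem _)
    (fun _ _ h1 h2 => add_mem h1 h2) (fun c _ h => Subalgebra.smul_mem _ h c) hf
  intro A B hA hB
  exact indicator_mem_rectangleAlgebra (hA.preimage (measurable_const_vadd g))
    (hB.preimage (measurable_const_vadd g))

theorem tendsto_sum_mul_integral_of_forall_prod {ι : ℕ → Type*} [∀ j, Fintype (ι j)]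
    {w : ∀ j, ι j → ℝ} {P : ∀ j, ι j → ProbabilityMeasure (X × Y)}
    {ν : ProbabilityMeasure (X × Y)}
    (hlim : ∀ A B, MeasurableSet A → MeasurableSet B →
      Tendsto (fun j => ∑ k, w j k * (P j k : Measure (X × Y)).real (A ×ˢ B)) atTop
        (𝓝 ((ν : Measure (X × Y)).real (A ×ˢ B)))) {f : X × Y → ℝ}
    (hf : f ∈ rectangleAlgebra X Y) :
    Tendsto (fun j => ∑ k, w j k * ∫ z, f z ∂(P j k : Measure (X × Y))) atTop
      (𝓝 (∫ z, f z ∂(ν : Measure (X × Y)))) := by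
  refine (rectangleAlgebra_induction (p := fun f =>
    (∀ ρ : ProbabilityMeasure (X × Y), Integrable f (ρ : Measure (X × Y))) ∧
    Tendsto (fun j => ∑ k, w j k * ∫ z, f z ∂(P j k : Measure (X × Y))) atTop
      (𝓝 (∫ z, f z ∂(ν : Measure (X × Y))))) ?_ ?_ ?_ ?_ hf).2
  · intro A B hA hB
    refine ⟨fun ρ => integrable_of_mem_rectangleAlgebra
      (indicator_mem_rectangleAlgebra hA hB) _, ?_⟩
    simpa only [integral_indicator_one (hA.prod hB)] using hlim A B hA hB
  · exact ⟨fun ρ => integrable_zero _ _ _, by simp⟩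
  · rintro f g ⟨hfi, hf⟩ ⟨hgi, hg⟩
    refine ⟨fun ρ => (hfi ρ).add (hgi ρ), ?_⟩
    simp only [Pi.add_apply, fun ρ => integral_add (hfi ρ) (hgi ρ), mul_add, Finset.sum_add_distrib]
    exact hf.add hg
  · rintro c f ⟨hfi, hf⟩
    refine ⟨fun ρ => (hfi ρ).smul c, ?_⟩
    simp only [Pi.smul_apply, smul_eq_mul, integral_const_mul, mul_left_comm _ c, ← Finset.mul_sum]
    exact hf.const_mul c

end Rectangles

/-! ### Weak convergence tested on rectangles -/

section WeakConvergence

/-- Convergence on a suitable countable family of open rectangles implies weak convergence. -/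
theorem exists_seq_prod_convergence_determining (X : Type*) [TopologicalSpace X]
    [SecondCountableTopology X] [MeasurableSpace X] [OpensMeasurableSpace X] :
    ∃ U V : ℕ → Set X, (∀ n, MeasurableSet (U n)) ∧ (∀ n, MeasurableSet (V n)) ∧
      ∀ (P : ℕ → ProbabilityMeasure (X × X)) (ν : ProbabilityMeasure (X × X)),
        (∀ n, Tendsto (fun j => (P j : Measure (X × X)).real (U n ×ˢ V n)) atTop
          (𝓝 ((ν : Measure (X × X)).real (U n ×ˢ V n)))) → Tendsto P atTop (𝓝 ν) := by
  let b := TopologicalSpace.countableBasis X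
  have hb := TopologicalSpace.isBasis_countableBasis X
  let 𝒰 : Set (Set X) := (fun t => ⋂₀ t) '' {t | t.Finite ∧ t ⊆ b}
  have h𝒰c : 𝒰.Countable :=
    (countable_ofPred_finite_subset (TopologicalSpace.countable_countableBasis X)).image _
  have h𝒰o : ∀ U ∈ 𝒰, IsOpen U := by
    rintro _ ⟨t, ⟨htf, htb⟩, rfl⟩
    exact htf.isOpen_sInter fun u hu => hb.isOpen (htb hu)
  have h𝒰i : ∀ U ∈ 𝒰, ∀ V ∈ 𝒰, U ∩ V ∈ 𝒰 := by
    rintro _ ⟨t, ⟨htf, htb⟩, rfl⟩ _ ⟨t', ⟨htf', htb'⟩, rfl⟩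
    exact ⟨t ∪ t', ⟨htf.union htf', union_subset htb htb'⟩, sInter_union _ _⟩
  have hb𝒰 : ∀ u ∈ b, u ∈ 𝒰 := fun u hu =>
    ⟨{u}, ⟨finite_singleton u, singleton_subset_iff.2 hu⟩, sInter_singleton u⟩
  have hne : 𝒰.Nonempty := ⟨_, ∅, ⟨finite_empty, empty_subset _⟩, rfl⟩
  obtain ⟨R, hR⟩ := (h𝒰c.prod h𝒰c).exists_eq_range (hne.prod hne)
  have hRmem : ∀ n, R n ∈ 𝒰 ×ˢ 𝒰 := fun n => hR ▸ mem_range_self n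
  refine ⟨fun n => (R n).1, fun n => (R n).2, fun n => (h𝒰o _ (hRmem n).1).measurableSet,
    fun n => (h𝒰o _ (hRmem n).2).measurableSet, fun P ν hlim => ?_⟩
  let S : Set (Set (X × X)) := {W | ∃ U ∈ 𝒰, ∃ V ∈ 𝒰, W = U ×ˢ V}
  refine IsPiSystem.tendsto_probabilityMeasure_of_tendsto_of_mem (S := S) ?_ ?_ ?_ ?_
  · rintro _ ⟨U, hU, V, hV, rfl⟩ _ ⟨U', hU', V', hV', rfl⟩ _
    exact ⟨_, h𝒰i U hU U' hU', _, h𝒰i V hV V' hV', prod_inter_prod⟩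
  · rintro _ ⟨U, hU, V, hV, rfl⟩
    exact (h𝒰o U hU).measurableSet.prod (h𝒰o V hV).measurableSet
  · rintro O hO ⟨x, y⟩ hxy
    obtain ⟨W, ⟨U, hU, V, hV, rfl⟩, hmem, hsub⟩ :=
      (hb.prod hb).exists_subset_of_mem_open hxy hO
    refine ⟨_, ⟨U, hb𝒰 U hU, V, hb𝒰 V hV, rfl⟩, ?_, hsub⟩
    exact ((hb.isOpen hU).prod (hb.isOpen hV)).mem_nhds hmem
  · rintro _ ⟨U, hU, V, hV, rfl⟩
    obtain ⟨n, hn⟩ : (U, V) ∈ range R := hR ▸ ⟨hU, hV⟩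
    have := hlim n
    simp only [hn] at this
    exact NNReal.tendsto_coe.1 this

end WeakConvergence

/-! ### Ergodic self-joinings as limits of off-diagonal joinings -/

theorem mainTheorem4 {X : Type*} [TopologicalSpace X] [PolishSpace X]
    [MeasurableSpace X] [BorelSpace X]
    (μ : ProbabilityMeasure X) [NullSingletonClass (μ : Measure X)]
    [AddAction ℝ X] [MeasurableVAdd₂ ℝ X] [VAddInvariantMeasure ℝ X (μ : Measure X)]
    (E : ℕ → Set X) (s : ℕ → ℝ) (h : ℕ → ℕ)
    (hflat : IsFlatRoofSequence (μ : Measure X) E s h)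
    (ν : ProbabilityMeasure (X × X)) (hν : IsSelfJoining μ ν)
    (hν_erg : ErgodicVAdd ℝ (X × X) (ν : Measure (X × X))) :
    ∃ k : ℕ → ℤ, Tendsto (fun j => offDiagonal μ ((k j : ℝ) * s j)) atTop (𝓝 ν) := by
  have : ∀ j, NeZero (h j) := fun j => ⟨(hflat.height_pos j).ne'⟩
  have : MeasurableConstVAdd ℝ (X × X) := measurableConstVAdd_prod
  obtain ⟨U, V, hU, hV, hUV⟩ := exists_seq_prod_convergence_determining X
  let w : ∀ j, ZMod (h j) → ℝ := fun j k =>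
    diagonalWeight (ν : Measure (X × X)) (E j) (s j) (h j) k
  let P : ∀ j, ZMod (h j) → ProbabilityMeasure (X × X) := fun j k => diagonalJoining μ (s j) k
  have hw0 : ∀ j k, 0 ≤ w j k := fun j k => diagonalWeight_nonneg _ _ _ _ _
  have hlim : ∀ A B, MeasurableSet A → MeasurableSet B →
      Tendsto (fun j => ∑ k, w j k * (P j k : Measure (X × X)).real (A ×ˢ B)) atTop
        (𝓝 ((ν : Measure (X × X)).real (A ×ˢ B))) :=
    fun A B hA hB => hflat.tendsto_sum_diagonalWeight_mul hν hA hB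
  have hw1 : Tendsto (fun j => ∑ k, w j k) atTop (𝓝 1) := by
    simpa using hlim univ univ .univ .univ
  have hvar : ∀ n, Tendsto (fun j => ∑ k, w j k * ((P j k : Measure (X × X)).real (U n ×ˢ V n)
      - (ν : Measure (X × X)).real (U n ×ˢ V n)) ^ 2) atTop (𝓝 0) := by
    intro n
    have h1 := tendsto_sum_mul_sq_integral_sub (G := ℝ) (ν := ν) (rectangleAlgebra X X)
      (fun _ => measurable_of_mem_rectangleAlgebra)
      (fun _ => exists_norm_le_of_mem_rectangleAlgebra)
      (fun _ hf g => comp_vadd_mem_rectangleAlgebra hf g) hw0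
      (P := P) (fun j k => (isSelfJoining_offDiagonal μ _).invariant)
      (fun _ hf => tendsto_sum_mul_integral_of_forall_prod hlim hf)
      (indicator_mem_rectangleAlgebra (hU n) (hV n))
    simpa only [integral_indicator_one ((hU n).prod (hV n))] using h1
  obtain ⟨k, hk⟩ := exists_forall_tendsto_of_tendsto_sum hw0 hw1
    (F := fun n j k => ((P j k : Measure (X × X)).real (U n ×ˢ V n)
      - (ν : Measure (X × X)).real (U n ×ˢ V n)) ^ 2)
    (fun n j k => sq_nonneg _) (fun n j k => by
      rw [sq_le_one_iff_abs_le_one, abs_le]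
      have h1 := measureReal_nonneg (μ := (P j k : Measure (X × X))) (s := U n ×ˢ V n)
      have h2 := measureReal_le_one (μ := (P j k : Measure (X × X))) (s := U n ×ˢ V n)
      have h3 := measureReal_nonneg (μ := (ν : Measure (X × X))) (s := U n ×ˢ V n)
      have h4 := measureReal_le_one (μ := (ν : Measure (X × X))) (s := U n ×ˢ V n)
      constructor <;> linarith) hvar (fun j => inferInstance)
  refine ⟨fun j => -((k j).val : ℤ), hUV _ ν fun n => ?_⟩
  have h1 := (hk n).sqrt
  simp only [Real.sqrt_sq_eq_abs, Real.sqrt_zero] at h1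
  exact tendsto_iff_norm_sub_tendsto_zero.2 h1
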